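/- For a Borel probability measure $\nu$ on $[0,1]$ with $\nu(\{0\})=0$, let $Y_1,Y_2,\dots$ be i.i.d. with law $\nu$, let $X_i=(1-Y_1)\cdots(1-Y_{i-1})\,Y_i$ for $i\ge 1$ (the residual allocation model from $\nu$; almost surely $\sum_{i\ge1}X_i=1$), and let $\varepsilon_1,\varepsilon_2,\dots$ be i.i.d. with $\mathbb P(\varepsilon_i=1)=\mathbb P(\varepsilon_i=0)=\tfrac12$, independent of $(Y_i)_{i\ge1}$. The law of $Z=\sum_{i\ge1}\varepsilon_iX_i$ is called the Bernoulli$(\tfrac12)$ convolution of $\nu$. Theorem. Let $\theta>0$ and let $\mu=\mathrm{Beta}(1,\theta)$, the probability measure on $[0,1]$ with density $\theta(1-x)^{\theta-1}$ on $(0,1)$. Then there exist infinitely many Borel probability measures $\nu\neq\mu$ on $[0,1]$ with $\nu(\{0\})=0$ such that $\mu$ and $\nu$ have identical Bernoulli$(\tfrac12)$ convolutions. Moreover, the Bernoulli$(\tfrac12)$ convolution of $\mu$ is the distribution $\mathrm{Beta}(\tfrac\theta2,\tfrac\theta2)$. -/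

import Mathlib

open MeasureTheory ProbabilityTheory

/-- The residual allocation (stick-breaking) sequence built from `y = (y₀, y₁, …)`:
`xᵢ = (1 - y₀) ⋯ (1 - yᵢ₋₁) yᵢ`. -/
def stickBreaking (y : ℕ → ℝ) (i : ℕ) : ℝ :=
  (∏ j ∈ Finset.range i, (1 - y j)) * y i

/-- The residual allocation model from a probability measure `μ` on `[0, 1]`: the law, on the space
of real sequences, of `(Xᵢ)` obtained by stick breaking from an i.i.d. sequence `(Yᵢ)` with
common law `μ`. -/
noncomputable def residualAllocation (μ : Measure ℝ) : Measure (ℕ → ℝ) :=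
  (Measure.infinitePi (fun _ : ℕ => μ)).map stickBreaking

/-- The Bernoulli(`p`) convolution of a random partition with law `κ`: the law of
`Z = ∑ᵢ εᵢ Xᵢ`, where `X = (Xᵢ)` has law `κ` and `ε = (εᵢ)` is an i.i.d. sequence of Bernoulli(`p`)
random variables (value `1` with probability `p`, value `0` with probability `1 - p`),
independent of `X`. -/
noncomputable def bernoulliConvolution (p : unitInterval) (κ : Measure (ℕ → ℝ)) : Measure ℝ :=
  (κ.prod (Measure.infinitePi (fun _ : ℕ => bernoulliMeasure (1 : ℝ) 0 p))).map
    (fun ω : (ℕ → ℝ) × (ℕ → ℝ) => ∑' i, ω.2 i * ω.1 i)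

/-! Removing the first stick and its mark leaves a rescaled independent copy of the same
configuration, so the law of the marked sum is a fixed point of `Z ↦ εY + (1 - Y)Z`. One step
multiplies the Lipschitz constant of a test function by `E[1 - Y]`, which is below 1 because `ν {0}
= 0`; hence there is only one fixed law on `[-1, 1]` (`perpetuityStep_fixed_unique`), and
identifying a convolution reduces to checking that a candidate is fixed
(`markedStickLaw_eq_of_fixed`).

Put `θ = 2a` and let `Z` be `Beta(a, a)`, which is symmetric under `x ↦ 1 - x`. If `(1 - Y)Z` has
density `h` relative to `Beta(a, a)`, then, since `1 - (Y + (1 - Y)Z) = (1 - Y)(1 - Z)`, the fair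
mixture `εY + (1 - Y)Z` has density `(h(x) + h(1 - x)) / 2`. So `Beta(a, a)` is fixed as soon as
`h(x) + h(1 - x) = 2`.

For `Y` of law `Beta(1, 2a)` one has `h = 2(1 - x)`. Adding `2t · x(1 - x)(1 - 2x)`, which is odd
under the reflection, keeps the condition. Moments show that this change of `h` comes from a
quadratic tilt of the density of `Y` (`integral_one_sub_pow_mul_integral_pow`). Small `t > 0` keep
the tilt nonnegative, and the means tell the resulting laws apart. -/

/-! ### Uniqueness for the perpetuity equation, by contraction. -/

/-- The law of `εY + (1 - Y)Z` for independent `Y`, `ε`, `Z` with laws `ν`, `b`, `m`. -/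
noncomputable def perpetuityStep (ν b m : Measure ℝ) : Measure ℝ :=
  ((ν.prod b).prod m).map (fun w => w.1.2 * w.1.1 + (1 - w.1.1) * w.2)

lemma integral_perpetuityStep (ν b m : Measure ℝ) [IsProbabilityMeasure ν]
    [IsProbabilityMeasure b] [IsProbabilityMeasure m] {E : Type*} [NormedAddCommGroup E]
    [NormedSpace ℝ E] {g : ℝ → E} (hg : Continuous g)
    (hint : Integrable g (perpetuityStep ν b m)) :
    ∫ x, g x ∂(perpetuityStep ν b m) =
      ∫ z, ∫ w, g (w.2 * w.1 + (1 - w.1) * z) ∂(ν.prod b) ∂m := by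
  have hmeas : Measurable (fun w : (ℝ × ℝ) × ℝ => w.1.2 * w.1.1 + (1 - w.1.1) * w.2) := by
    fun_prop
  unfold perpetuityStep at hint ⊢
  rw [integral_map hmeas.aemeasurable (hg.stronglyMeasurable.aestronglyMeasurable)]
  rw [integral_prod_symm]
  exact (integrable_map_measure hg.stronglyMeasurable.aestronglyMeasurable
    hmeas.aemeasurable).1 hint

lemma integrable_of_norm_le_one {α E : Type*} [MeasurableSpace α] [NormedAddCommGroup E]
    {μ : Measure α} [IsFiniteMeasure μ] {g : α → E} (hm : AEStronglyMeasurable g μ)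
    (hg : ∀ x, ‖g x‖ ≤ 1) : Integrable g μ :=
  Integrable.of_bound hm 1 (Filter.Eventually.of_forall hg)

/-- Invariance of `l` and `m` lets `g` be replaced by its average over one step, which has the same
sup bound and a Lipschitz constant smaller by the factor `E[1 - Y]`. The induction therefore
quantifies over `C` and `g`. -/
lemma norm_integral_sub_le_of_fixed (ν b : Measure ℝ) [IsProbabilityMeasure ν]
    [IsProbabilityMeasure b] (hν : ∀ᵐ y ∂ν, y ∈ Set.Icc (0 : ℝ) 1)
    (l m : Measure ℝ) [IsProbabilityMeasure l] [IsProbabilityMeasure m]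
    (hl1 : ∀ᵐ x ∂l, |x| ≤ 1) (hm1 : ∀ᵐ x ∂m, |x| ≤ 1)
    (hl : perpetuityStep ν b l = l) (hm : perpetuityStep ν b m = m) (n : ℕ) :
    ∀ (C : ℝ) (g : ℝ → ℂ), 0 ≤ C → (∀ x y, ‖g x - g y‖ ≤ C * |x - y|) → Continuous g →
      (∀ x, ‖g x‖ ≤ 1) →
      ‖∫ x, g x ∂l - ∫ x, g x ∂m‖ ≤ 2 * C * (∫ y, (1 - y) ∂ν) ^ n := by
  induction n with
  | zero =>
    intro C g hC hlip hcont hbd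
    -- Both laws live on `[-1, 1]`, so each integral is within `C` of `g 0`; this gives the factor
    -- 2.
    have key : ∀ (k : Measure ℝ) [IsProbabilityMeasure k], (∀ᵐ x ∂k, |x| ≤ 1) →
        ‖∫ x, g x ∂k - g 0‖ ≤ C := by
      intro k _ hk
      have : ∫ x, g x ∂k - g 0 = ∫ x, (g x - g 0) ∂k := by
        rw [integral_sub (integrable_of_norm_le_one hcont.aestronglyMeasurable hbd)
          (integrable_const _)]
        simp
      rw [this]
      have h2 := norm_integral_le_of_norm_le_const (μ := k) (f := fun x => g x - g 0) (C := C) ?_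
      · simpa using h2
      · filter_upwards [hk] with x hx
        refine (hlip x 0).trans ?_
        rw [sub_zero]
        exact mul_le_of_le_one_right hC hx
    have h1 := key l hl1
    have h2 := key m hm1
    calc ‖∫ x, g x ∂l - ∫ x, g x ∂m‖ = ‖(∫ x, g x ∂l - g 0) - (∫ x, g x ∂m - g 0)‖ := by
          congr 1; ring
      _ ≤ _ := norm_sub_le _ _
      _ ≤ 2 * C * (∫ y, (1 - y) ∂ν) ^ 0 := by rw [pow_zero]; linarith
  | succ n ih =>
    intro C g hC hlip hcont hbd
    set q := ∫ y, (1 - y) ∂ν with hq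
    have hq0 : 0 ≤ q := integral_nonneg_of_ae (by
      filter_upwards [hν] with y hy
      simpa using hy.2)
    have hyint : Integrable (fun y : ℝ => 1 - y) ν := by
      refine Integrable.of_bound (by fun_prop) 1 ?_
      filter_upwards [hν] with y hy
      rw [Real.norm_eq_abs, abs_le]
      constructor <;> linarith [hy.1, hy.2]
    have hyint2 : Integrable (fun w : ℝ × ℝ => 1 - w.1) (ν.prod b) := hyint.comp_fst b
    have hν2 : ∀ᵐ w ∂(ν.prod b), w.1 ∈ Set.Icc (0 : ℝ) 1 :=
      Measure.quasiMeasurePreserving_fst.ae hν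
    have hint2 : ∫ w : ℝ × ℝ, (1 - w.1) ∂(ν.prod b) = q := by
      rw [integral_fun_fst (fun y : ℝ => 1 - y)]; simp [hq]
    set K : ℝ → ℂ := fun z => ∫ w, g (w.2 * w.1 + (1 - w.1) * z) ∂(ν.prod b) with hK
    have hgi : ∀ z, Integrable (fun w : ℝ × ℝ => g (w.2 * w.1 + (1 - w.1) * z)) (ν.prod b) := by
      intro z
      exact integrable_of_norm_le_one (hcont.comp (by fun_prop)).aestronglyMeasurable
        (fun _ => hbd _)
    have hKlip : ∀ x y, ‖K x - K y‖ ≤ C * q * |x - y| := by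
      intro x y
      rw [hK]
      simp only
      rw [← integral_sub (hgi x) (hgi y)]
      calc _ ≤ ∫ w : ℝ × ℝ, C * |x - y| * (1 - w.1) ∂(ν.prod b) := by
            refine norm_integral_le_of_norm_le (hyint2.const_mul _) ?_
            filter_upwards [hν2] with w hw
            -- The term with the mark cancels in the difference, leaving `(1 - y)(x - y')` for the
            -- two starting points.
            refine (hlip _ _).trans (le_of_eq ?_)
            have : w.2 * w.1 + (1 - w.1) * x - (w.2 * w.1 + (1 - w.1) * y) =
              (1 - w.1) * (x - y) := by ring
            rw [this, abs_mul, abs_of_nonneg (by linarith [hw.2])]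
            ring
        _ = C * q * |x - y| := by
            rw [integral_const_mul, hint2]; ring
    have hKcont : Continuous K := by
      have : LipschitzWith (Real.toNNReal (C * q)) K := by
        refine LipschitzWith.of_dist_le_mul fun x y => ?_
        rw [dist_eq_norm, Real.dist_eq, Real.coe_toNNReal _ (by positivity)]
        exact hKlip x y
      exact this.continuous
    have hKbd : ∀ z, ‖K z‖ ≤ 1 := by
      intro z
      have := norm_integral_le_of_norm_le_const (μ := ν.prod b)
        (f := fun w : ℝ × ℝ => g (w.2 * w.1 + (1 - w.1) * z)) (C := 1)
        (Filter.Eventually.of_forall fun _ => hbd _)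
      simpa using this
    have h1 : ∀ (k : Measure ℝ) [IsProbabilityMeasure k], perpetuityStep ν b k = k →
        ∫ x, g x ∂k = ∫ z, K z ∂k := by
      intro k _ hk
      conv_lhs => rw [← hk]
      refine integral_perpetuityStep ν b k hcont ?_
      rw [hk]
      exact integrable_of_norm_le_one hcont.aestronglyMeasurable hbd
    rw [h1 l hl, h1 m hm]
    refine (ih (C * q) K (by positivity) hKlip hKcont hKbd).trans (le_of_eq ?_)
    ring

lemma integral_one_sub_lt_one (ν : Measure ℝ) [IsProbabilityMeasure ν]
    (hν : ∀ᵐ y ∂ν, y ∈ Set.Icc (0 : ℝ) 1) (h0 : ν {0} = 0) :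
    ∫ y, (1 - y) ∂ν < 1 := by
  have hint : Integrable (fun y : ℝ => y) ν := by
    refine Integrable.of_bound (by fun_prop) 1 ?_
    filter_upwards [hν] with y hy
    rw [Real.norm_eq_abs, abs_le]
    constructor <;> linarith [hy.1, hy.2]
  have hpos : 0 < ∫ y, y ∂ν := by
    rw [integral_pos_iff_support_of_nonneg_ae (by filter_upwards [hν] with y hy using hy.1) hint]
    have : Function.support (fun y : ℝ => y) = {0}ᶜ := by ext; simp
    rw [this, prob_compl_eq_one_sub (measurableSet_singleton _), h0]
    simp
  rw [integral_sub (integrable_const _) hint]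
  simp
  exact hpos

/-- The perpetuity equation `Z = εY + (1 - Y)Z` has at most one solution in law. -/
theorem perpetuityStep_fixed_unique (ν b : Measure ℝ) [IsProbabilityMeasure ν]
    [IsProbabilityMeasure b] (hν : ∀ᵐ y ∂ν, y ∈ Set.Icc (0 : ℝ) 1) (h0 : ν {0} = 0)
    (l m : Measure ℝ) [IsProbabilityMeasure l] [IsProbabilityMeasure m]
    (hl1 : ∀ᵐ x ∂l, |x| ≤ 1) (hm1 : ∀ᵐ x ∂m, |x| ≤ 1)
    (hl : perpetuityStep ν b l = l) (hm : perpetuityStep ν b m = m) : l = m := by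
  refine Measure.ext_of_charFun (funext fun t => ?_)
  rw [charFun_apply_real, charFun_apply_real]
  have hq1 := integral_one_sub_lt_one ν hν h0
  have hq0 : 0 ≤ ∫ y, (1 - y) ∂ν := integral_nonneg_of_ae (by
      filter_upwards [hν] with y hy
      simpa using hy.2)
  -- Characters are bounded by 1 and `|t|`-Lipschitz, hence admissible test functions.
  have hlip : ∀ x y : ℝ, ‖Complex.exp (t * x * Complex.I) - Complex.exp (t * y * Complex.I)‖
      ≤ |t| * |x - y| := by
    intro x y
    have h : Complex.exp (t * x * Complex.I) - Complex.exp (t * y * Complex.I) =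
        Complex.exp ((t * y : ℝ) * Complex.I) *
          (Complex.exp (Complex.I * (t * (x - y) : ℝ)) - 1) := by
      rw [mul_sub, ← Complex.exp_add, mul_one]
      congr 1
      · congr 1; push_cast; ring
      · congr 1; push_cast; ring
    rw [h, norm_mul, Complex.norm_exp_ofReal_mul_I, one_mul]
    refine (Real.norm_exp_I_mul_ofReal_sub_one_le).trans ?_
    rw [Real.norm_eq_abs, abs_mul]
  have hb := fun n => norm_integral_sub_le_of_fixed ν b hν l m hl1 hm1 hl hm n |t|
    (fun x => Complex.exp (t * x * Complex.I)) (abs_nonneg t) hlip (by fun_prop) (fun x => by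
      have := Complex.norm_exp_ofReal_mul_I (t * x)
      push_cast at this
      exact this.le)
  have hlim := (tendsto_pow_atTop_nhds_zero_of_lt_one hq0 hq1).const_mul (2 * |t|)
  rw [mul_zero] at hlim
  have := ge_of_tendsto' hlim hb
  exact sub_eq_zero.1 (norm_le_zero_iff.1 this)

/-! ### Stick breaking and the self-similarity of the marked sum. -/

/-- The sequence with head `w.1` and tail `w.2`. -/
def consSeq {α : Type*} (w : α × (ℕ → α)) (n : ℕ) : α := Nat.casesOn n w.1 w.2

lemma measurable_consSeq : Measurable (consSeq : ℝ × (ℕ → ℝ) → ℕ → ℝ) := by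
  refine measurable_pi_lambda _ fun n => ?_
  cases n with
  | zero => exact measurable_fst
  | succ n => exact (measurable_pi_apply n).comp measurable_snd

/-- An i.i.d. sequence is an independent first term followed by a copy of itself; it suffices to
compare masses of finite-dimensional boxes. -/
lemma map_consSeq_infinitePi (ν : Measure ℝ) [IsProbabilityMeasure ν] :
    (ν.prod (Measure.infinitePi fun _ : ℕ => ν)).map consSeq =
      Measure.infinitePi fun _ : ℕ => ν := by
  classical
  refine Measure.eq_infinitePi _ fun s t ht => ?_
  obtain ⟨N, hN⟩ : ∃ N, s ⊆ Finset.range (N + 1) :=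
    ⟨s.sup id, fun i hi => Finset.mem_range.2 (Nat.lt_succ_of_le (Finset.le_sup (f := id) hi))⟩
  -- Padding with `univ` makes the box constrain an initial segment of indices, so the head
  -- coordinate always splits off, even when `0 ∉ s`.
  set t' : ℕ → Set ℝ := fun i => if i ∈ s then t i else Set.univ with ht'
  have ht'm : ∀ i, MeasurableSet (t' i) := fun i => by
    rw [ht']; dsimp only; split_ifs
    exacts [ht i, .univ]
  have hpre : consSeq ⁻¹' (Set.pi s t) =
      t' 0 ×ˢ Set.pi (Finset.range N : Set ℕ) (fun i => t' (i + 1)) := by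
    ext w
    simp only [Set.mem_preimage, Set.mem_pi, Set.mem_prod, SetLike.mem_coe, Finset.mem_range, ht']
    constructor
    · intro h
      refine ⟨?_, fun i _ => ?_⟩
      · split_ifs with h0
        exacts [h 0 h0, trivial]
      · split_ifs with h0
        exacts [h (i + 1) h0, trivial]
    · rintro ⟨h0, h1⟩ i hi
      cases i with
      | zero => rw [if_pos hi] at h0; exact h0
      | succ i =>
        have := h1 i (by have := Finset.mem_range.1 (hN hi); omega)
        rw [if_pos hi] at this; exact this
  rw [Measure.map_apply measurable_consSeq
    (MeasurableSet.pi s.countable_toSet fun i _ => ht i), hpre, Measure.prod_prod,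
    Measure.infinitePi_pi _ (fun i _ => ht'm _)]
  have : ∏ i ∈ s, ν (t i) = ∏ i ∈ Finset.range (N + 1), ν (t' i) := by
    rw [← Finset.prod_subset hN (f := fun i => ν (t' i))]
    · exact Finset.prod_congr rfl fun i hi => by simp [ht', hi]
    · intro i _ hi
      simp [ht', hi]
  rw [this, Finset.prod_range_succ', mul_comm]

/-- Regroups (first stick, other sticks) and (first mark, other marks) into (first stick, first
mark) and the rest. -/
lemma measurePreserving_prodProdProdComm {α β γ δ : Type*} [MeasurableSpace α]
    [MeasurableSpace β] [MeasurableSpace γ] [MeasurableSpace δ]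
    (μa : Measure α) (μb : Measure β) (μc : Measure γ) (μd : Measure δ)
    [SFinite μa] [SFinite μb] [SFinite μc] [SFinite μd] :
    MeasurePreserving (fun w : (α × β) × (γ × δ) => ((w.1.1, w.2.1), (w.1.2, w.2.2)))
      ((μa.prod μb).prod (μc.prod μd)) ((μa.prod μc).prod (μb.prod μd)) := by
  have e1 := measurePreserving_prodAssoc μa μb (μc.prod μd)
  have e2 := (MeasurePreserving.id μa).prod
    ((measurePreserving_prodAssoc μb μc μd).symm)
  have e3 := (MeasurePreserving.id μa).prod
    ((Measure.measurePreserving_swap (μ := μb) (ν := μc)).prod (MeasurePreserving.id μd))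
  have e4 := (MeasurePreserving.id μa).prod (measurePreserving_prodAssoc μc μb μd)
  have e5 := (measurePreserving_prodAssoc μa μc (μb.prod μd)).symm
  exact e5.comp (e4.comp (e3.comp (e2.comp e1)))

lemma stickBreaking_zero (y : ℕ → ℝ) : stickBreaking y 0 = y 0 := by simp [stickBreaking]

lemma stickBreaking_consSeq_succ (a : ℝ) (y : ℕ → ℝ) (i : ℕ) :
    stickBreaking (consSeq (a, y)) (i + 1) = (1 - a) * stickBreaking y i := by
  unfold stickBreaking
  rw [Finset.prod_range_succ']
  have h0 : consSeq (a, y) 0 = a := rfl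
  have h1 : ∀ j, consSeq (a, y) (j + 1) = y j := fun _ => rfl
  simp only [h0, h1]
  ring

lemma sum_stickBreaking (y : ℕ → ℝ) (n : ℕ) :
    ∑ i ∈ Finset.range n, stickBreaking y i = 1 - ∏ j ∈ Finset.range n, (1 - y j) := by
  induction n with
  | zero => simp
  | succ n ih =>
    rw [Finset.sum_range_succ, ih, Finset.prod_range_succ, stickBreaking]; ring

lemma stickBreaking_nonneg {y : ℕ → ℝ} (hy : ∀ i, y i ∈ Set.Icc (0 : ℝ) 1) (i : ℕ) :
    0 ≤ stickBreaking y i :=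
  mul_nonneg (Finset.prod_nonneg fun j _ => by linarith [(hy j).2]) (hy i).1

lemma measurable_stickBreaking : Measurable stickBreaking := by
  unfold stickBreaking
  fun_prop

/-- Pairs of a partition `x` and marks `e` for which `∑ eᵢ xᵢ` has nonnegative terms and partial
sums at most `1`. -/
def subunitPairs : Set ((ℕ → ℝ) × (ℕ → ℝ)) :=
  {w | (∀ i, 0 ≤ w.2 i * w.1 i) ∧ ∀ n, ∑ i ∈ Finset.range n, w.2 i * w.1 i ≤ 1}

lemma measurableSet_subunitPairs : MeasurableSet subunitPairs := by
  have h : subunitPairs = (⋂ i, {w | 0 ≤ w.2 i * w.1 i}) ∩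
      ⋂ n, {w | ∑ i ∈ Finset.range n, w.2 i * w.1 i ≤ 1} := by
    ext w
    simp [subunitPairs]
  rw [h]
  exact (MeasurableSet.iInter fun i => measurableSet_le (by fun_prop) (by fun_prop)).inter
    (MeasurableSet.iInter fun i => measurableSet_le (by fun_prop) (by fun_prop))

lemma summable_of_mem_subunitPairs {w : (ℕ → ℝ) × (ℕ → ℝ)} (hw : w ∈ subunitPairs) :
    Summable (fun i => w.2 i * w.1 i) :=
  summable_of_sum_range_le hw.1 hw.2

lemma tsum_mem_Icc_of_mem_subunitPairs {w : (ℕ → ℝ) × (ℕ → ℝ)} (hw : w ∈ subunitPairs) :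
    ∑' i, w.2 i * w.1 i ∈ Set.Icc (0 : ℝ) 1 :=
  ⟨tsum_nonneg hw.1, Real.tsum_le_of_sum_range_le hw.1 hw.2⟩

lemma stickBreaking_mem_subunitPairs {y e : ℕ → ℝ} (hy : ∀ i, y i ∈ Set.Icc (0 : ℝ) 1)
    (he : ∀ i, e i ∈ Set.Icc (0 : ℝ) 1) : (stickBreaking y, e) ∈ subunitPairs := by
  refine ⟨fun i => mul_nonneg (he i).1 (stickBreaking_nonneg hy i), fun n => ?_⟩
  calc ∑ i ∈ Finset.range n, e i * stickBreaking y i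
      ≤ ∑ i ∈ Finset.range n, stickBreaking y i :=
        Finset.sum_le_sum fun i _ => mul_le_of_le_one_left (stickBreaking_nonneg hy i) (he i).2
    _ ≤ 1 := by
        rw [sum_stickBreaking]
        have : 0 ≤ ∏ j ∈ Finset.range n, (1 - y j) :=
          Finset.prod_nonneg fun j _ => by linarith [(hy j).2]
        linarith

/-- Needed because `Measure.map` is zero along a function that is not a.e. measurable. Almost surely
the series converges, so the sum is an a.e. limit of measurable partial sums. -/
lemma aemeasurable_tsum_mul {P : Measure ((ℕ → ℝ) × (ℕ → ℝ))} (hP : ∀ᵐ w ∂P, w ∈ subunitPairs) :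
    AEMeasurable (fun w : (ℕ → ℝ) × (ℕ → ℝ) => ∑' i, w.2 i * w.1 i) P := by
  refine aemeasurable_of_tendsto_metrizable_ae Filter.atTop
    (f := fun n w => ∑ i ∈ Finset.range n, w.2 i * w.1 i) (fun n => by fun_prop) ?_
  filter_upwards [hP] with w hw
  exact (summable_of_mem_subunitPairs hw).hasSum.tendsto_sum_nat

lemma ae_infinitePi_forall {ν : Measure ℝ} [IsProbabilityMeasure ν] {s : Set ℝ}
    (h : ∀ᵐ y ∂ν, y ∈ s) : ∀ᵐ y ∂(Measure.infinitePi fun _ : ℕ => ν), ∀ i, y i ∈ s := by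
  rw [ae_all_iff]
  intro i
  exact (measurePreserving_eval_infinitePi (fun _ : ℕ => ν) i).quasiMeasurePreserving.ae h

section Law

variable (ν b : Measure ℝ) [IsProbabilityMeasure ν] [IsProbabilityMeasure b]

/-- The law of `∑ εᵢ Xᵢ` for `X` obtained by stick breaking from an i.i.d. sequence with law `ν`
and an independent i.i.d. sequence `ε` with law `b`. -/
noncomputable def markedStickLaw : Measure ℝ :=
  ((residualAllocation ν).prod (Measure.infinitePi fun _ : ℕ => b)).map
    (fun w : (ℕ → ℝ) × (ℕ → ℝ) => ∑' i, w.2 i * w.1 i)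

variable {ν b}

lemma residualAllocation_prod :
    (residualAllocation ν).prod (Measure.infinitePi fun _ : ℕ => b) =
      ((Measure.infinitePi fun _ : ℕ => ν).prod (Measure.infinitePi fun _ : ℕ => b)).map
        (Prod.map stickBreaking id) := by
  rw [← Measure.map_prod_map _ _ measurable_stickBreaking measurable_id, Measure.map_id]
  rfl

lemma ae_mem_Icc_seq (hν : ∀ᵐ y ∂ν, y ∈ Set.Icc (0 : ℝ) 1) (hb : ∀ᵐ y ∂b, y ∈ Set.Icc (0 : ℝ) 1) :
    ∀ᵐ w ∂((Measure.infinitePi fun _ : ℕ => ν).prod (Measure.infinitePi fun _ : ℕ => b)),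
      (∀ i, w.1 i ∈ Set.Icc (0 : ℝ) 1) ∧ ∀ i, w.2 i ∈ Set.Icc (0 : ℝ) 1 :=
  (Measure.quasiMeasurePreserving_fst.ae (ae_infinitePi_forall hν)).and
    (Measure.quasiMeasurePreserving_snd.ae (ae_infinitePi_forall hb))

lemma ae_mem_subunitPairs (hν : ∀ᵐ y ∂ν, y ∈ Set.Icc (0 : ℝ) 1)
    (hb : ∀ᵐ y ∂b, y ∈ Set.Icc (0 : ℝ) 1) :
    ∀ᵐ w ∂((residualAllocation ν).prod (Measure.infinitePi fun _ : ℕ => b)),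
      w ∈ subunitPairs := by
  rw [residualAllocation_prod]
  refine (ae_map_iff (p := fun w => w ∈ subunitPairs)
    (measurable_stickBreaking.prodMap measurable_id).aemeasurable measurableSet_subunitPairs).2 ?_
  filter_upwards [ae_mem_Icc_seq hν hb] with w hw
  exact stickBreaking_mem_subunitPairs hw.1 hw.2

instance : IsProbabilityMeasure (residualAllocation ν) :=
  Measure.isProbabilityMeasure_map measurable_stickBreaking.aemeasurable

lemma isProbabilityMeasure_markedStickLaw (hν : ∀ᵐ y ∂ν, y ∈ Set.Icc (0 : ℝ) 1)
    (hb : ∀ᵐ y ∂b, y ∈ Set.Icc (0 : ℝ) 1) : IsProbabilityMeasure (markedStickLaw ν b) :=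
  Measure.isProbabilityMeasure_map (aemeasurable_tsum_mul (ae_mem_subunitPairs hν hb))

lemma ae_abs_le_one_markedStickLaw (hν : ∀ᵐ y ∂ν, y ∈ Set.Icc (0 : ℝ) 1)
    (hb : ∀ᵐ y ∂b, y ∈ Set.Icc (0 : ℝ) 1) : ∀ᵐ x ∂(markedStickLaw ν b), |x| ≤ 1 := by
  unfold markedStickLaw
  rw [ae_map_iff (aemeasurable_tsum_mul (ae_mem_subunitPairs hν hb))
    (measurableSet_le (by fun_prop) (by fun_prop))]
  filter_upwards [ae_mem_subunitPairs hν hb] with w hw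
  have := tsum_mem_Icc_of_mem_subunitPairs hw
  rw [abs_of_nonneg this.1]
  exact this.2

lemma markedStickLaw_eq_map (hν : ∀ᵐ y ∂ν, y ∈ Set.Icc (0 : ℝ) 1)
    (hb : ∀ᵐ y ∂b, y ∈ Set.Icc (0 : ℝ) 1) :
    markedStickLaw ν b =
      ((Measure.infinitePi fun _ : ℕ => ν).prod (Measure.infinitePi fun _ : ℕ => b)).map
        (fun w => ∑' i, w.2 i * stickBreaking w.1 i) := by
  have h := aemeasurable_tsum_mul (ae_mem_subunitPairs hν hb)
  unfold markedStickLaw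
  rw [residualAllocation_prod] at h ⊢
  rw [AEMeasurable.map_map_of_aemeasurable h
    (measurable_stickBreaking.prodMap measurable_id).aemeasurable]
  rfl

lemma aemeasurable_tsum_mul_stickBreaking (hν : ∀ᵐ y ∂ν, y ∈ Set.Icc (0 : ℝ) 1)
    (hb : ∀ᵐ y ∂b, y ∈ Set.Icc (0 : ℝ) 1) :
    AEMeasurable (fun w : (ℕ → ℝ) × (ℕ → ℝ) => ∑' i, w.2 i * stickBreaking w.1 i)
      ((Measure.infinitePi fun _ : ℕ => ν).prod (Measure.infinitePi fun _ : ℕ => b)) := by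
  have h := aemeasurable_tsum_mul (ae_mem_subunitPairs hν hb)
  rw [residualAllocation_prod] at h
  exact h.comp_aemeasurable (measurable_stickBreaking.prodMap measurable_id).aemeasurable

lemma tsum_consSeq {y e : ℕ → ℝ} (hy : ∀ i, y i ∈ Set.Icc (0 : ℝ) 1)
    (he : ∀ i, e i ∈ Set.Icc (0 : ℝ) 1) (a c : ℝ) :
    ∑' i, consSeq (c, e) i * stickBreaking (consSeq (a, y)) i =
      c * a + (1 - a) * ∑' i, e i * stickBreaking y i := by
  have hs := summable_of_mem_subunitPairs (stickBreaking_mem_subunitPairs hy he)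
  have hsucc : ∀ i, consSeq (c, e) (i + 1) * stickBreaking (consSeq (a, y)) (i + 1) =
      (1 - a) * (e i * stickBreaking y i) := by
    intro i
    rw [stickBreaking_consSeq_succ]
    simp only [consSeq]
    ring
  rw [tsum_eq_zero_add']
  · simp_rw [hsucc]
    rw [tsum_mul_left, stickBreaking_zero]
    rfl
  · simp_rw [hsucc]
    exact hs.mul_left _

/-- The marked stick-breaking sum solves the perpetuity equation. -/
theorem perpetuityStep_markedStickLaw (hν : ∀ᵐ y ∂ν, y ∈ Set.Icc (0 : ℝ) 1)
    (hb : ∀ᵐ y ∂b, y ∈ Set.Icc (0 : ℝ) 1) :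
    perpetuityStep ν b (markedStickLaw ν b) = markedStickLaw ν b := by
  set N := Measure.infinitePi fun _ : ℕ => ν
  set B := Measure.infinitePi fun _ : ℕ => b
  set F : (ℕ → ℝ) × (ℕ → ℝ) → ℝ := fun w => ∑' i, w.2 i * stickBreaking w.1 i
  have hF : AEMeasurable F (N.prod B) := aemeasurable_tsum_mul_stickBreaking hν hb
  have hcons : Measurable (Prod.map consSeq consSeq :
      (ℝ × (ℕ → ℝ)) × (ℝ × (ℕ → ℝ)) → (ℕ → ℝ) × (ℕ → ℝ)) :=
    measurable_consSeq.prodMap measurable_consSeq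
  have hNB : N.prod B = ((ν.prod N).prod (b.prod B)).map (Prod.map consSeq consSeq) := by
    rw [← Measure.map_prod_map _ _ measurable_consSeq measurable_consSeq,
      map_consSeq_infinitePi, map_consSeq_infinitePi]
  have hcomm := measurePreserving_prodProdProdComm ν N b B
  set A : (ℝ × ℝ) × ℝ → ℝ := fun w => w.1.2 * w.1.1 + (1 - w.1.1) * w.2
  have hA : Measurable A := by fun_prop
  have hlaw : markedStickLaw ν b = (N.prod B).map F := markedStickLaw_eq_map hν hb
  have hprod : (ν.prod b).prod (markedStickLaw ν b) =
      ((ν.prod b).prod (N.prod B)).map (Prod.map id F) := by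
    -- `F` is only a.e. measurable, so the product of maps is computed with a measurable version.
    obtain ⟨G, hG, hFG⟩ := hF
    rw [hlaw, Measure.map_congr hFG]
    have h2 : (Prod.map id F : (ℝ × ℝ) × ((ℕ → ℝ) × (ℕ → ℝ)) → (ℝ × ℝ) × ℝ)
        =ᵐ[(ν.prod b).prod (N.prod B)] Prod.map id G := by
      filter_upwards [Measure.quasiMeasurePreserving_snd.ae hFG] with w hw
      simp only [Prod.map, hw]
    rw [Measure.map_congr h2, ← Measure.map_prod_map _ _ measurable_id hG, Measure.map_id]
  have hF2 : AEMeasurable (Prod.map id F : (ℝ × ℝ) × ((ℕ → ℝ) × (ℕ → ℝ)) → (ℝ × ℝ) × ℝ)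
      ((ν.prod b).prod (N.prod B)) := by
    refine AEMeasurable.prodMk measurable_fst.aemeasurable ?_
    exact hF.comp_quasiMeasurePreserving Measure.quasiMeasurePreserving_snd
  unfold perpetuityStep
  rw [hprod, AEMeasurable.map_map_of_aemeasurable hA.aemeasurable hF2, ← hcomm.map_eq]
  rw [← hcomm.map_eq] at hF2
  rw [AEMeasurable.map_map_of_aemeasurable (hA.comp_aemeasurable hF2) hcomm.measurable.aemeasurable,
    hlaw]
  conv_rhs => rw [hNB]
  rw [hNB] at hF
  rw [AEMeasurable.map_map_of_aemeasurable hF hcons.aemeasurable]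
  refine Measure.map_congr ?_
  have hae := hcomm.quasiMeasurePreserving.ae
    (Measure.quasiMeasurePreserving_snd.ae (ae_mem_Icc_seq hν hb))
  filter_upwards [hae] with w hw
  exact (tsum_consSeq hw.1 hw.2 w.1.1 w.2.1).symm

/-- A solution of the perpetuity equation on `[-1, 1]` is the law of the marked sum. -/
theorem markedStickLaw_eq_of_fixed (hν : ∀ᵐ y ∂ν, y ∈ Set.Icc (0 : ℝ) 1)
    (hb : ∀ᵐ y ∂b, y ∈ Set.Icc (0 : ℝ) 1) (h0 : ν {0} = 0) (m : Measure ℝ)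
    [IsProbabilityMeasure m] (hm1 : ∀ᵐ x ∂m, |x| ≤ 1) (hm : perpetuityStep ν b m = m) :
    markedStickLaw ν b = m := by
  have := isProbabilityMeasure_markedStickLaw hν hb
  exact perpetuityStep_fixed_unique ν b hν h0 _ _ (ae_abs_le_one_markedStickLaw hν hb) hm1
    (perpetuityStep_markedStickLaw hν hb) hm

end Law

/-! ### Polynomial test functions and moments of Beta laws. -/

/-- A probability measure on `[0, 1]` is determined by its integrals of polynomials. -/
theorem ext_of_integral_polynomial_Icc {μ ν : Measure ℝ} [IsProbabilityMeasure μ]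
    [IsProbabilityMeasure ν] (hμ : ∀ᵐ x ∂μ, x ∈ Set.Icc (0 : ℝ) 1)
    (hν : ∀ᵐ x ∂ν, x ∈ Set.Icc (0 : ℝ) 1)
    (h : ∀ p : Polynomial ℝ, ∫ x, p.eval x ∂μ = ∫ x, p.eval x ∂ν) : μ = ν := by
  refine ext_of_forall_integral_eq_of_IsFiniteMeasure fun f => ?_
  refine eq_of_forall_dist_le fun ε hε => ?_
  -- Weierstrass approximation on `[0, 1]`, with an error of `ε / 2` for each measure.
  obtain ⟨p, hp⟩ := exists_polynomial_near_of_continuousOn 0 1 f f.continuous.continuousOn (ε / 2)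
    (by positivity)
  have key : ∀ (k : Measure ℝ) [IsProbabilityMeasure k], (∀ᵐ x ∂k, x ∈ Set.Icc (0 : ℝ) 1) →
      |∫ x, p.eval x ∂k - ∫ x, f x ∂k| ≤ ε / 2 := by
    intro k _ hk
    have hfi : Integrable f k := f.integrable k
    have hdiff : ∀ᵐ x ∂k, ‖p.eval x - f x‖ ≤ ε / 2 := by
      filter_upwards [hk] with x hx using (hp x hx).le
    have hdi : Integrable (fun x => p.eval x - f x) k :=
      Integrable.of_bound (by
        exact (p.continuous.sub f.continuous).aestronglyMeasurable) _ hdiff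
    have hpi : Integrable (fun x => p.eval x) k := by
      exact (hdi.add hfi).congr (Filter.Eventually.of_forall fun x => sub_add_cancel _ _)
    rw [← integral_sub hpi hfi]
    simpa using norm_integral_le_of_norm_le_const hdiff
  have h1 := abs_le.1 (key μ hμ)
  have h2 := abs_le.1 (key ν hν)
  rw [Real.dist_eq, abs_le]
  rw [h p] at h1
  constructor <;> linarith [h1.1, h1.2, h2.1, h2.2]

lemma betaPDFReal_nonneg {α β : ℝ} (hα : 0 < α) (hβ : 0 < β) (x : ℝ) :
    0 ≤ betaPDFReal α β x := by
  by_cases hx : 0 < x ∧ x < 1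
  · exact (betaPDFReal_pos hx.1 hx.2 hα hβ).le
  · rw [betaPDFReal, if_neg hx]

lemma measurable_betaPDF (α β : ℝ) : Measurable (betaPDF α β) :=
  (measurable_betaPDFReal α β).ennreal_ofReal

lemma integral_betaMeasure {α β : ℝ} (hα : 0 < α) (hβ : 0 < β) (f : ℝ → ℝ) :
    ∫ x, f x ∂(betaMeasure α β) = ∫ x, betaPDFReal α β x * f x := by
  unfold betaMeasure
  rw [integral_withDensity_eq_integral_toReal_smul (measurable_betaPDF α β)
    (Filter.Eventually.of_forall fun x => ENNReal.ofReal_lt_top)]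
  refine integral_congr_ae (Filter.Eventually.of_forall fun x => ?_)
  simp only [betaPDF, smul_eq_mul]
  rw [ENNReal.toReal_ofReal (betaPDFReal_nonneg hα hβ x)]

lemma ae_mem_Ioo_betaMeasure (α β : ℝ) : ∀ᵐ x ∂(betaMeasure α β), x ∈ Set.Ioo (0 : ℝ) 1 := by
  unfold betaMeasure
  rw [ae_withDensity_iff (measurable_betaPDF α β)]
  refine Filter.Eventually.of_forall fun x hx => ?_
  by_contra hcon
  exact hx (by rw [betaPDF_eq, if_neg (show ¬(0 < x ∧ x < 1) from hcon)]; simp)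

lemma integral_betaPDFReal {α β : ℝ} (hα : 0 < α) (hβ : 0 < β) :
    ∫ x, betaPDFReal α β x = 1 := by
  have := integral_betaMeasure hα hβ (fun _ => 1)
  have hP := isProbabilityMeasureBeta hα hβ
  simpa using this.symm

/-- The extra powers turn the density into a multiple of another Beta density, whose total mass is
1. -/
lemma integral_pow_mul_one_sub_pow_betaMeasure {α β : ℝ} (hα : 0 < α) (hβ : 0 < β) (i j : ℕ) :
    ∫ x, x ^ i * (1 - x) ^ j ∂(betaMeasure α β) = beta (α + i) (β + j) / beta α β := by
  have hαi : 0 < α + i := by positivity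
  have hβj : 0 < β + j := by positivity
  rw [integral_betaMeasure hα hβ]
  have h : ∀ x, betaPDFReal α β x * (x ^ i * (1 - x) ^ j) =
      beta (α + i) (β + j) / beta α β * betaPDFReal (α + i) (β + j) x := by
    intro x
    unfold betaPDFReal
    split_ifs with hx
    · have h1 : 0 < 1 - x := by linarith [hx.2]
      rw [show α + i - 1 = α - 1 + i by ring, show β + j - 1 = β - 1 + j by ring,
        Real.rpow_add_natCast hx.1.ne', Real.rpow_add_natCast h1.ne']
      have := (beta_pos hα hβ).ne'
      have := (beta_pos hαi hβj).ne'
      field_simp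
    · simp
  simp_rw [h]
  rw [integral_const_mul, integral_betaPDFReal hαi hβj, mul_one]

lemma beta_add_one_left {α β : ℝ} (hα : 0 < α) (hβ : 0 < β) :
    beta (α + 1) β = beta α β * (α / (α + β)) := by
  unfold beta
  rw [show α + 1 + β = α + β + 1 by ring, Real.Gamma_add_one hα.ne',
    Real.Gamma_add_one (by positivity)]
  have := (Real.Gamma_pos_of_pos (add_pos hα hβ)).ne'
  field_simp

lemma beta_one_left {β : ℝ} (hβ : 0 < β) : beta 1 β = 1 / β := by
  unfold beta
  rw [add_comm 1 β, Real.Gamma_add_one hβ.ne', Real.Gamma_one]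
  have := (Real.Gamma_pos_of_pos hβ).ne'
  field_simp

lemma integral_pow_succ_betaMeasure {α β : ℝ} (hα : 0 < α) (hβ : 0 < β) (n : ℕ) :
    ∫ x, x ^ (n + 1) ∂(betaMeasure α β) =
      (∫ x, x ^ n ∂(betaMeasure α β)) * ((α + n) / (α + β + n)) := by
  have h := integral_pow_mul_one_sub_pow_betaMeasure hα hβ (n + 1) 0
  have h' := integral_pow_mul_one_sub_pow_betaMeasure hα hβ n 0
  simp only [pow_zero, mul_one, Nat.cast_zero, add_zero] at h h'
  rw [h, h', Nat.cast_succ, ← add_assoc, beta_add_one_left (by positivity) hβ]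
  rw [show α + n + β = α + β + n by ring]
  ring

lemma integral_one_sub_pow_betaMeasure_one {β : ℝ} (hβ : 0 < β) (n : ℕ) :
    ∫ x, (1 - x) ^ n ∂(betaMeasure 1 β) = β / (β + n) := by
  have h := integral_pow_mul_one_sub_pow_betaMeasure one_pos hβ 0 n
  simp only [pow_zero, one_mul, Nat.cast_zero, add_zero] at h
  rw [h, beta_one_left hβ, beta_one_left (by positivity)]
  have : β + n ≠ 0 := by positivity
  field_simp

lemma integral_comp_one_sub_betaMeasure {α : ℝ} (hα : 0 < α) (f : ℝ → ℝ) :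
    ∫ x, f (1 - x) ∂(betaMeasure α α) = ∫ x, f x ∂(betaMeasure α α) := by
  rw [integral_betaMeasure hα hα, integral_betaMeasure hα hα,
    ← integral_sub_left_eq_self (fun x => betaPDFReal α α x * f x) volume 1]
  refine integral_congr_ae (Filter.Eventually.of_forall fun x => ?_)
  simp only
  congr 1
  unfold betaPDFReal
  have : (0 < 1 - x ∧ 1 - x < 1) ↔ (0 < x ∧ x < 1) := by 
    constructor <;> rintro ⟨h, h'⟩ <;> constructor <;> linarith
  simp only [this]
  split_ifs
  · rw [sub_sub_cancel]; ring
  · rfl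

/-- Continuous functions are integrable against measures carried by `[0, 1]`. -/
lemma integrable_of_continuous_Icc {k : Measure ℝ} [IsFiniteMeasure k]
    (hk : ∀ᵐ x ∂k, x ∈ Set.Icc (0 : ℝ) 1) {f : ℝ → ℝ} (hf : Continuous f) : Integrable f k := by
  obtain ⟨C, hC⟩ := isCompact_Icc.exists_bound_of_continuousOn (s := Set.Icc (0 : ℝ) 1)
    hf.continuousOn
  refine Integrable.of_bound hf.aestronglyMeasurable C ?_
  filter_upwards [hk] with x hx using hC x hx

/-! ### The tilted stick-breaking laws and their moments. -/

/-- The density, relative to `Beta(1, 2a)`, of a perturbation leaving the convolution unchanged. -/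
noncomputable def tiltDensity (a t y : ℝ) : ℝ :=
  1 + t * (-1 + 3 * (a + 1) * y - (a + 1) * (a + 2) * y ^ 2)

/-- The perturbed stick-breaking law. -/
noncomputable def tiltedBeta (a t : ℝ) : Measure ℝ :=
  (betaMeasure 1 (2 * a)).withDensity fun y => ENNReal.ofReal (tiltDensity a t y)

@[fun_prop]
lemma continuous_tiltDensity (a t : ℝ) : Continuous (tiltDensity a t) := by
  unfold tiltDensity; fun_prop

/-- On `[0, 1]` the linear term is nonnegative and `y ^ 2 ≤ 1`, so the tilt is at least `1 - t(1 +
(a + 1)(a + 2))`; this dictates the bound on `t`. -/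
lemma tiltDensity_nonneg {a t : ℝ} (ha : 0 < a) (ht0 : 0 ≤ t)
    (ht : t ≤ 1 / (1 + (a + 1) * (a + 2))) {y : ℝ} (hy : y ∈ Set.Icc (0 : ℝ) 1) :
    0 ≤ tiltDensity a t y := by
  unfold tiltDensity
  rw [le_div_iff₀ (by positivity)] at ht
  have h1 : 0 ≤ t * (3 * (a + 1) * y) := by have := hy.1; positivity
  have h2 : t * ((a + 1) * (a + 2) * y ^ 2) ≤ t * ((a + 1) * (a + 2)) := by
    refine mul_le_mul_of_nonneg_left ?_ ht0
    refine mul_le_of_le_one_right (by positivity) ?_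
    exact pow_le_one₀ hy.1 hy.2
  linarith

lemma ae_mem_Icc_tiltedBeta (a t : ℝ) : ∀ᵐ y ∂(tiltedBeta a t), y ∈ Set.Icc (0 : ℝ) 1 :=
  (withDensity_absolutelyContinuous _ _).ae_le
    ((ae_mem_Ioo_betaMeasure _ _).mono fun _ h => Set.Ioo_subset_Icc_self h)

lemma tiltedBeta_singleton_zero (a t : ℝ) : tiltedBeta a t {0} = 0 := by
  refine withDensity_absolutelyContinuous _ _ ?_
  -- The second density reduces from the Beta law to Lebesgue measure.
  refine withDensity_absolutelyContinuous _ _ ?_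
  simp

lemma tiltedBeta_zero (a : ℝ) : tiltedBeta a 0 = betaMeasure 1 (2 * a) := by
  unfold tiltedBeta tiltDensity
  simp

lemma integral_tiltedBeta {a t : ℝ} (ha : 0 < a) (ht0 : 0 ≤ t)
    (ht : t ≤ 1 / (1 + (a + 1) * (a + 2))) (f : ℝ → ℝ) :
    ∫ y, f y ∂(tiltedBeta a t) = ∫ y, tiltDensity a t y * f y ∂(betaMeasure 1 (2 * a)) := by
  unfold tiltedBeta
  rw [integral_withDensity_eq_integral_toReal_smul
    (by fun_prop) (Filter.Eventually.of_forall fun x => ENNReal.ofReal_lt_top)]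
  refine integral_congr_ae ?_
  filter_upwards [ae_mem_Ioo_betaMeasure _ _] with y hy
  rw [ENNReal.toReal_ofReal (tiltDensity_nonneg ha ht0 ht (Set.Ioo_subset_Icc_self hy)),
    smul_eq_mul]

/-- Expanding the tilt in powers of `1 - y` gives a partial fraction in `n` with poles at `-2a`,
`-2a - 1`, `-2a - 2`. These are the poles that the moment ratios of `Beta(a, a)` produce for a cubic
`h`. -/
lemma integral_one_sub_pow_tiltedBeta {a t : ℝ} (ha : 0 < a) (ht0 : 0 ≤ t)
    (ht : t ≤ 1 / (1 + (a + 1) * (a + 2))) (n : ℕ) :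
    ∫ y, (1 - y) ^ n ∂(tiltedBeta a t) =
      (1 - t + t * (3 * (a + 1) - (a + 1) * (a + 2))) * (2 * a / (2 * a + n))
        + t * (2 * (a + 1) * (a + 2) - 3 * (a + 1)) * (2 * a / (2 * a + n + 1))
        - t * ((a + 1) * (a + 2)) * (2 * a / (2 * a + n + 2)) := by
  have h2a : 0 < 2 * a := by positivity
  have := isProbabilityMeasureBeta one_pos h2a
  have hk : ∀ᵐ y ∂(betaMeasure 1 (2 * a)), y ∈ Set.Icc (0 : ℝ) 1 :=
    (ae_mem_Ioo_betaMeasure _ _).mono fun _ h => Set.Ioo_subset_Icc_self h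
  rw [integral_tiltedBeta ha ht0 ht]
  have h : ∀ y : ℝ, tiltDensity a t y * (1 - y) ^ n =
      (1 - t + t * (3 * (a + 1) - (a + 1) * (a + 2))) * (1 - y) ^ n
        + t * (2 * (a + 1) * (a + 2) - 3 * (a + 1)) * (1 - y) ^ (n + 1)
        - t * ((a + 1) * (a + 2)) * (1 - y) ^ (n + 2) := by
    intro y; unfold tiltDensity; ring
  have hi : ∀ (c : ℝ) (k : ℕ), Integrable (fun y : ℝ => c * (1 - y) ^ k) (betaMeasure 1 (2 * a)) :=
    fun c k => integrable_of_continuous_Icc hk (by fun_prop)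
  simp_rw [h]
  rw [integral_sub ?_ (hi _ _), integral_add (hi _ _) (hi _ _)]
  · simp only [integral_const_mul, integral_one_sub_pow_betaMeasure_one h2a]
    push_cast
    simp only [add_assoc]
  · exact integrable_of_continuous_Icc hk (by fun_prop)

/-- The total mass is the moment formula at `n = 0`, where the terms in `t` cancel. -/
lemma isProbabilityMeasure_tiltedBeta {a t : ℝ} (ha : 0 < a) (ht0 : 0 ≤ t)
    (ht : t ≤ 1 / (1 + (a + 1) * (a + 2))) : IsProbabilityMeasure (tiltedBeta a t) := by
  have h2a : 0 < 2 * a := by positivity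
  have := isProbabilityMeasureBeta one_pos h2a
  have hk : ∀ᵐ y ∂(betaMeasure 1 (2 * a)), y ∈ Set.Icc (0 : ℝ) 1 :=
    (ae_mem_Ioo_betaMeasure _ _).mono fun _ h => Set.Ioo_subset_Icc_self h
  have h := integral_one_sub_pow_tiltedBeta ha ht0 ht 0
  rw [integral_tiltedBeta ha ht0 ht] at h
  simp only [pow_zero, mul_one, Nat.cast_zero, add_zero] at h
  constructor
  unfold tiltedBeta
  rw [withDensity_apply _ .univ, Measure.restrict_univ, ← ofReal_integral_eq_lintegral_ofReal
    (integrable_of_continuous_Icc hk (by fun_prop))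
    (by filter_upwards [hk] with y hy using tiltDensity_nonneg ha ht0 ht hy), h,
    ENNReal.ofReal_eq_one]
  field_simp
  ring

lemma integral_id_tiltedBeta {a t : ℝ} (ha : 0 < a) (ht0 : 0 ≤ t)
    (ht : t ≤ 1 / (1 + (a + 1) * (a + 2))) :
    ∫ y, y ∂(tiltedBeta a t) = 1 / (2 * a + 1) + t * (a / ((2 * a + 1) * (2 * a + 3))) := by
  have := isProbabilityMeasure_tiltedBeta ha ht0 ht
  have h := integral_one_sub_pow_tiltedBeta ha ht0 ht 1
  have hi : Integrable (fun y : ℝ => y) (tiltedBeta a t) :=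
    integrable_of_continuous_Icc (ae_mem_Icc_tiltedBeta a t) continuous_id
  simp only [pow_one, Nat.cast_one] at h
  rw [integral_sub (integrable_const _) hi, integral_const] at h
  simp only [probReal_univ, smul_eq_mul, mul_one] at h
  have h2 : ∫ y, y ∂(tiltedBeta a t) = 1 - (1 - ∫ y, y ∂(tiltedBeta a t)) := by ring
  rw [h2, h]
  field_simp
  ring

/-- The moments of `(1 - Y)Z` for `Y` with the tilted law and `Z` with law `Beta(a, a)`. -/
lemma integral_one_sub_pow_mul_integral_pow {a t : ℝ} (ha : 0 < a) (ht0 : 0 ≤ t)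
    (ht : t ≤ 1 / (1 + (a + 1) * (a + 2))) (n : ℕ) :
    (∫ y, (1 - y) ^ n ∂(tiltedBeta a t)) * ∫ x, x ^ n ∂(betaMeasure a a) =
      ∫ x, x ^ n * (2 * (1 - x) + 2 * t * (x * (1 - x) * (1 - 2 * x))) ∂(betaMeasure a a) := by
  have := isProbabilityMeasureBeta ha ha
  have hk : ∀ᵐ y ∂(betaMeasure a a), y ∈ Set.Icc (0 : ℝ) 1 :=
    (ae_mem_Ioo_betaMeasure _ _).mono fun _ h => Set.Ioo_subset_Icc_self h
  have hi : ∀ (c : ℝ) (k : ℕ), Integrable (fun y : ℝ => c * y ^ k) (betaMeasure a a) :=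
    fun c k => integrable_of_continuous_Icc hk (by fun_prop)
  have h : ∀ x : ℝ, x ^ n * (2 * (1 - x) + 2 * t * (x * (1 - x) * (1 - 2 * x))) =
      2 * x ^ n + (2 * t - 2) * x ^ (n + 1) + (- 6 * t) * x ^ (n + 2) + 4 * t * x ^ (n + 3) := by
    intro x; ring
  simp_rw [h]
  have h1 : Integrable (fun x : ℝ => 2 * x ^ n + (2 * t - 2) * x ^ (n + 1)) (betaMeasure a a) :=
    integrable_of_continuous_Icc hk (by fun_prop)
  have h2 : Integrable (fun x : ℝ => 2 * x ^ n + (2 * t - 2) * x ^ (n + 1)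
      + (- 6 * t) * x ^ (n + 2)) (betaMeasure a a) :=
    integrable_of_continuous_Icc hk (by fun_prop)
  rw [integral_add h2 (hi _ _), integral_add h1 (hi _ _), integral_add (hi _ _) (hi _ _)]
  clear h1 h2
  simp only [integral_const_mul, integral_one_sub_pow_tiltedBeta ha ht0 ht]
  -- All moments become multiples of the `n`-th one, and an identity of rational functions in `n`
  -- remains.
  rw [integral_pow_succ_betaMeasure ha ha (n + 2), integral_pow_succ_betaMeasure ha ha (n + 1),
    integral_pow_succ_betaMeasure ha ha n]
  push_cast
  generalize ∫ x, x ^ n ∂(betaMeasure a a) = M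
  have hn : (0 : ℝ) ≤ n := n.cast_nonneg
  generalize (n : ℝ) = s at hn
  rw [show a + a + s = 2 * a + s by ring, show a + a + (s + 1) = 2 * a + s + 1 by ring,
    show a + a + (s + 2) = 2 * a + s + 2 by ring]
  have h1 : 2 * a + s ≠ 0 := by positivity
  have h2 : 2 * a + s + 1 ≠ 0 := by positivity
  have h3 : 2 * a + s + 2 ≠ 0 := by positivity
  field_simp
  ring

/-! ### The fixed-point equation for `Beta(a, a)`. -/

/-- The fair coin on `{0, 1}`. -/
noncomputable def fairCoin : Measure ℝ :=
  bernoulliMeasure (1 : ℝ) 0 ⟨1 / 2, by norm_num, by norm_num⟩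

instance : IsProbabilityMeasure fairCoin := by unfold fairCoin; infer_instance

lemma integral_fairCoin (f : ℝ → ℝ) : ∫ e, f e ∂fairCoin = (f 1 + f 0) / 2 := by
  unfold fairCoin
  rw [integral_bernoulliMeasure]
  simp only [smul_eq_mul]
  ring

lemma ae_mem_Icc_fairCoin : ∀ᵐ e ∂fairCoin, e ∈ Set.Icc (0 : ℝ) 1 := by
  unfold fairCoin
  rw [bernoulliMeasure_def, ae_add_measure_iff]
  constructor
  · refine Measure.ae_smul_measure ?_ _
    exact (ae_dirac_iff (p := fun e : ℝ => e ∈ Set.Icc (0 : ℝ) 1) measurableSet_Icc).2 (by simp)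
  · refine Measure.ae_smul_measure ?_ _
    exact (ae_dirac_iff (p := fun e : ℝ => e ∈ Set.Icc (0 : ℝ) 1) measurableSet_Icc).2 (by simp)

lemma bernoulliConvolution_half_eq (ν : Measure ℝ) :
    bernoulliConvolution ⟨1 / 2, by norm_num, by norm_num⟩ (residualAllocation ν) =
      markedStickLaw ν fairCoin := rfl

lemma ae_mem_Icc_betaMeasure (α β : ℝ) : ∀ᵐ x ∂(betaMeasure α β), x ∈ Set.Icc (0 : ℝ) 1 :=
  (ae_mem_Ioo_betaMeasure _ _).mono fun _ h => Set.Ioo_subset_Icc_self h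

instance isProbabilityMeasure_perpetuityStep (ν b m : Measure ℝ) [IsProbabilityMeasure ν]
    [IsProbabilityMeasure b] [IsProbabilityMeasure m] :
    IsProbabilityMeasure (perpetuityStep ν b m) :=
  Measure.isProbabilityMeasure_map (by fun_prop)

lemma ae_mem_Icc_perpetuityStep {ν b m : Measure ℝ} [IsProbabilityMeasure ν]
    [IsProbabilityMeasure b] [IsProbabilityMeasure m] (hν : ∀ᵐ y ∂ν, y ∈ Set.Icc (0 : ℝ) 1)
    (hb : ∀ᵐ y ∂b, y ∈ Set.Icc (0 : ℝ) 1) (hm : ∀ᵐ y ∂m, y ∈ Set.Icc (0 : ℝ) 1) :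
    ∀ᵐ x ∂(perpetuityStep ν b m), x ∈ Set.Icc (0 : ℝ) 1 := by
  unfold perpetuityStep
  refine (ae_map_iff (p := fun x => x ∈ Set.Icc (0 : ℝ) 1) (by fun_prop) measurableSet_Icc).2 ?_
  filter_upwards [Measure.quasiMeasurePreserving_fst.ae
    (Measure.quasiMeasurePreserving_fst.ae hν), Measure.quasiMeasurePreserving_fst.ae
    (Measure.quasiMeasurePreserving_snd.ae hb), Measure.quasiMeasurePreserving_snd.ae hm]
    with w h1 h2 h3
  obtain ⟨h10, h11⟩ := h1
  obtain ⟨h20, h21⟩ := h2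
  obtain ⟨h30, h31⟩ := h3
  have h4 : 0 ≤ 1 - w.1.1 := by linarith
  constructor
  · positivity
  · have := mul_le_mul_of_nonneg_right h21 h10
    have := mul_le_mul_of_nonneg_left h31 h4
    linarith

/-- Averaging over `y` yields a polynomial in `z` whose coefficients involve only the moments of `1
- Y`, so moment identities extend to polynomial test functions. -/
lemma integral_eval_one_sub_mul {ν : Measure ℝ} [IsFiniteMeasure ν]
    (hν : ∀ᵐ y ∂ν, y ∈ Set.Icc (0 : ℝ) 1) (p : Polynomial ℝ) (z : ℝ) :
    ∫ y, p.eval ((1 - y) * z) ∂ν = ∑ i ∈ Finset.range (p.natDegree + 1),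
      p.coeff i * (∫ y, (1 - y) ^ i ∂ν) * z ^ i := by
  simp_rw [Polynomial.eval_eq_sum_range]
  rw [integral_finsetSum _ fun i _ => integrable_of_continuous_Icc hν (by fun_prop)]
  refine Finset.sum_congr rfl fun i _ => ?_
  simp_rw [mul_pow]
  rw [integral_const_mul, integral_mul_const, mul_assoc]

/-- Integrating a polynomial of `(1 - y) z`. -/
lemma integral_integral_eval_one_sub_mul {a t : ℝ} (ha : 0 < a) (ht0 : 0 ≤ t)
    (ht : t ≤ 1 / (1 + (a + 1) * (a + 2))) (p : Polynomial ℝ) :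
    ∫ z, ∫ y, p.eval ((1 - y) * z) ∂(tiltedBeta a t) ∂(betaMeasure a a) =
      ∫ x, p.eval x * (2 * (1 - x) + 2 * t * (x * (1 - x) * (1 - 2 * x))) ∂(betaMeasure a a) := by
  have := isProbabilityMeasureBeta ha ha
  have := isProbabilityMeasure_tiltedBeta ha ht0 ht
  simp_rw [integral_eval_one_sub_mul (ae_mem_Icc_tiltedBeta a t) p,
    Polynomial.eval_eq_sum_range, Finset.sum_mul]
  rw [integral_finsetSum _ fun i _ =>
      integrable_of_continuous_Icc (ae_mem_Icc_betaMeasure a a) (by fun_prop),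
    integral_finsetSum _ fun i _ =>
      integrable_of_continuous_Icc (ae_mem_Icc_betaMeasure a a) (by fun_prop)]
  refine Finset.sum_congr rfl fun i _ => ?_
  simp_rw [mul_assoc (p.coeff i)]
  rw [integral_const_mul, integral_const_mul, integral_const_mul,
    integral_one_sub_pow_mul_integral_pow ha ht0 ht]

/-- `Beta(a, a)` solves the perpetuity equation for every tilted stick-breaking law. -/
theorem perpetuityStep_tiltedBeta {a t : ℝ} (ha : 0 < a) (ht0 : 0 ≤ t)
    (ht : t ≤ 1 / (1 + (a + 1) * (a + 2))) :
    perpetuityStep (tiltedBeta a t) fairCoin (betaMeasure a a) = betaMeasure a a := by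
  have := isProbabilityMeasureBeta ha ha
  have := isProbabilityMeasure_tiltedBeta ha ht0 ht
  have hm := ae_mem_Icc_betaMeasure a a
  have hν := ae_mem_Icc_tiltedBeta a t
  have hstep := ae_mem_Icc_perpetuityStep hν ae_mem_Icc_fairCoin hm
  refine ext_of_integral_polynomial_Icc hstep hm fun p => ?_
  rw [integral_perpetuityStep _ _ _ p.continuous
    (integrable_of_continuous_Icc hstep p.continuous)]
  -- When the coin shows 1, `y + (1 - y)z = 1 - (1 - y)(1 - z)`, so the reflected polynomial brings
  -- this case to the form `(1 - y) z` of the other.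
  set p' := p.comp (1 - Polynomial.X) with hp'
  have hp'e : ∀ x, p'.eval x = p.eval (1 - x) := fun x => by simp [hp']
  have hinner : ∀ᵐ z ∂(betaMeasure a a),
      ∫ w, p.eval (w.2 * w.1 + (1 - w.1) * z) ∂((tiltedBeta a t).prod fairCoin) =
      (∫ y, p'.eval ((1 - y) * (1 - z)) ∂(tiltedBeta a t)
        + ∫ y, p.eval ((1 - y) * z) ∂(tiltedBeta a t)) / 2 := by
    filter_upwards [hm] with z hz
    have hcont : Continuous fun w : ℝ × ℝ => p.eval (w.2 * w.1 + (1 - w.1) * z) :=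
      p.continuous.comp (by fun_prop)
    obtain ⟨C, hC⟩ := (isCompact_Icc.prod isCompact_Icc).exists_bound_of_continuousOn
      (s := Set.Icc (0 : ℝ) 1 ×ˢ Set.Icc (0 : ℝ) 1) hcont.continuousOn
    rw [integral_prod _ (Integrable.of_bound hcont.aestronglyMeasurable C (by
      filter_upwards [Measure.quasiMeasurePreserving_fst.ae hν,
        Measure.quasiMeasurePreserving_snd.ae ae_mem_Icc_fairCoin] with w h1 h2
        using hC w ⟨h1, h2⟩))]
    simp_rw [integral_fairCoin]
    have hi : ∀ c : ℝ, Integrable (fun y => p.eval (c * y + (1 - y) * z)) (tiltedBeta a t) :=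
      fun c => integrable_of_continuous_Icc hν (p.continuous.comp (by fun_prop))
    rw [integral_div, integral_add (hi 1) (hi 0)]
    congr 2
    · refine integral_congr_ae (Filter.Eventually.of_forall fun y => ?_)
      simp only [hp'e]
      congr 1; ring
    · simp
  have hc : ∀ (r : Polynomial ℝ), Continuous fun z =>
      ∫ y, r.eval ((1 - y) * z) ∂(tiltedBeta a t) := by
    intro r
    simp_rw [integral_eval_one_sub_mul hν r]
    fun_prop
  have hi : Integrable (fun z => ∫ y, p'.eval ((1 - y) * (1 - z)) ∂(tiltedBeta a t))
      (betaMeasure a a) :=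
    integrable_of_continuous_Icc hm ((hc p').comp (continuous_const.sub continuous_id))
  rw [integral_congr_ae hinner, integral_div, integral_add hi
    (integrable_of_continuous_Icc hm (hc p)),
    integral_comp_one_sub_betaMeasure ha
      (fun z => ∫ y, p'.eval ((1 - y) * z) ∂(tiltedBeta a t)),
    integral_integral_eval_one_sub_mul ha ht0 ht, integral_integral_eval_one_sub_mul ha ht0 ht,
    ← integral_comp_one_sub_betaMeasure ha
      (fun x => p'.eval x * (2 * (1 - x) + 2 * t * (x * (1 - x) * (1 - 2 * x)))),
    ← integral_add (integrable_of_continuous_Icc hm (by fun_prop))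
      (integrable_of_continuous_Icc hm (by fun_prop)), ← integral_div]
  -- What remains is `(h(1 - x) + h(x)) / 2 = 1`: the linear parts add up to 2 and the cubic parts
  -- cancel.
  refine integral_congr_ae (Filter.Eventually.of_forall fun x => ?_)
  simp only [hp'e, sub_sub_cancel]
  ring

lemma markedStickLaw_tiltedBeta {a t : ℝ} (ha : 0 < a) (ht0 : 0 ≤ t)
    (ht : t ≤ 1 / (1 + (a + 1) * (a + 2))) :
    markedStickLaw (tiltedBeta a t) fairCoin = betaMeasure a a := by
  have := isProbabilityMeasureBeta ha ha
  have := isProbabilityMeasure_tiltedBeta ha ht0 ht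
  refine markedStickLaw_eq_of_fixed (ae_mem_Icc_tiltedBeta a t) ae_mem_Icc_fairCoin
    (tiltedBeta_singleton_zero a t) _ ?_ (perpetuityStep_tiltedBeta ha ht0 ht)
  filter_upwards [ae_mem_Icc_betaMeasure a a] with x hx
  rw [abs_of_nonneg hx.1]
  exact hx.2

/-! ### Infinitely many laws with the same convolution. -/

/-- The mean is affine in the parameter with nonzero slope. -/
lemma injOn_tiltedBeta {a : ℝ} (ha : 0 < a) :
    Set.InjOn (tiltedBeta a) (Set.Icc 0 (1 / (1 + (a + 1) * (a + 2)))) := by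
  intro s hs t ht h
  have h1 := integral_id_tiltedBeta ha hs.1 hs.2
  rw [h, integral_id_tiltedBeta ha ht.1 ht.2] at h1
  have hc : a / ((2 * a + 1) * (2 * a + 3)) ≠ 0 := by positivity
  exact (mul_right_cancel₀ hc (add_left_cancel h1)).symm

theorem theorem2 (θ : ℝ) (hθ : 0 < θ) :
    {ν : Measure ℝ | IsProbabilityMeasure ν ∧ ν (Set.Icc 0 1) = 1 ∧ ν {0} = 0 ∧
        ν ≠ betaMeasure 1 θ ∧
        bernoulliConvolution ⟨1 / 2, by norm_num, by norm_num⟩ (residualAllocation ν) =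
          bernoulliConvolution ⟨1 / 2, by norm_num, by norm_num⟩
            (residualAllocation (betaMeasure 1 θ))}.Infinite ∧
      bernoulliConvolution ⟨1 / 2, by norm_num, by norm_num⟩
          (residualAllocation (betaMeasure 1 θ)) = betaMeasure (θ / 2) (θ / 2) := by
  obtain ⟨a, rfl⟩ : ∃ a, θ = 2 * a := ⟨θ / 2, by ring⟩
  have ha : 0 < a := by linarith
  rw [show 2 * a / 2 = a by ring]
  set T := 1 / (1 + (a + 1) * (a + 2)) with hT
  have hT0 : 0 < T := by positivity
  have hbase : bernoulliConvolution ⟨1 / 2, by norm_num, by norm_num⟩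
      (residualAllocation (betaMeasure 1 (2 * a))) = betaMeasure a a := by
    rw [bernoulliConvolution_half_eq, ← tiltedBeta_zero]
    exact markedStickLaw_tiltedBeta ha le_rfl hT0.le
  refine ⟨?_, hbase⟩
  -- The parameter 0 is left out because it gives `Beta(1, 2a)` itself.
  have hinf : (tiltedBeta a '' Set.Ioc 0 T).Infinite :=
    (Set.Ioc_infinite hT0).image ((injOn_tiltedBeta ha).mono Set.Ioc_subset_Icc_self)
  refine hinf.mono ?_
  rintro _ ⟨t, ⟨ht0, ht⟩, rfl⟩
  have hP := isProbabilityMeasure_tiltedBeta ha ht0.le ht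
  refine ⟨hP, ?_, tiltedBeta_singleton_zero a t, ?_, ?_⟩
  · exact prob_compl_eq_zero_iff measurableSet_Icc |>.1 (ae_mem_Icc_tiltedBeta a t)
  · intro h
    rw [← tiltedBeta_zero] at h
    exact ht0.ne' (injOn_tiltedBeta ha ⟨ht0.le, ht⟩ ⟨le_rfl, hT0.le⟩ h)
  · rw [hbase, bernoulliConvolution_half_eq]
    exact markedStickLaw_tiltedBeta ha ht0.le ht
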